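/- Fix an acceptable numbering $\varphi_0,\varphi_1,\dots$ of the partial recursive functions and let $W_e$ be the domain of $\varphi_e$. A class $\mathcal C$ of subsets of $\mathbb N$ is *uniformly r.e.* if $\mathcal C=\{W_i : i\in S\}$ for some r.e. set $S\subseteq\mathbb N$; it is *one-one r.e.* if $S$ can moreover be chosen so that $W_i\neq W_j$ for distinct $i,j\in S$. Let $\eta$ be a positive (that is, recursively enumerable) equivalence relation on $\mathbb N$ with infinitely many equivalence classes. A set is *$\eta$-finite* (resp. *$\eta$-infinite*) if it is a union of finitely many, possibly zero (resp. infinitely many) $\eta$-equivalence classes, and *$\eta$-closed* if it is $\eta$-finite or $\eta$-infinite. Let $a_0<a_1<a_2<\cdots$ be the least elements of the $\eta$-equivalence classes in increasing order, let $A_n$ be the union of the equivalence classes of $a_0,\dots,a_{n-1}$, and let $\mathcal A_\eta=\{A_n : n\in\mathbb N\}$ (the *ascending family* for $\eta$). An *$\eta$-family* is an infinite one-one r.e. class all of whose members are $\eta$-closed. **Proposition.** Every uniformly r.e. class $\mathcal C\supseteq\mathcal A_\eta$ consisting of $\eta$-closed sets is an $\eta$-family. In particular, the class of all $\eta$-finite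 sets and the class of all $\eta$-closed r.e. sets are $\eta$-families. -/

import Mathlib

/-- `W e` is the `e`-th recursively enumerable set: the domain of the `e`-th partial recursive
function in the standard acceptable numbering. -/
def W (e : ℕ) : Set ℕ :=
  {x | ((Denumerable.ofNat Nat.Partrec.Code e).eval x).Dom}

/-- A class of sets is uniformly r.e. if it is `{W i : i ∈ S}` for some r.e. set `S`. -/
def UniformlyRE (C : Set (Set ℕ)) : Prop :=
  ∃ S : Set ℕ, REPred (fun i => i ∈ S) ∧ C = W '' S

/-- A class of sets is one-one r.e. if it is `{W i : i ∈ S}` for some r.e. set `S` on which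
distinct indices give distinct sets. -/
def OneOneRE (C : Set (Set ℕ)) : Prop :=
  ∃ S : Set ℕ, REPred (fun i => i ∈ S) ∧ C = W '' S ∧ Set.InjOn W S

/-- A positive equivalence relation is an equivalence relation on `ℕ` that is recursively
enumerable as a set of pairs. -/
def IsPositive (η : Setoid ℕ) : Prop :=
  REPred (fun p : ℕ × ℕ => η p.1 p.2)

/-- A set is `η`-finite if it is a union of finitely many (possibly no) `η`-classes. -/
def IsEtaFinite (η : Setoid ℕ) (L : Set ℕ) : Prop :=
  ∃ D : Set (Set ℕ), D ⊆ η.classes ∧ D.Finite ∧ L = ⋃₀ D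

/-- A set is `η`-infinite if it is a union of infinitely many `η`-classes. -/
def IsEtaInfinite (η : Setoid ℕ) (L : Set ℕ) : Prop :=
  ∃ D : Set (Set ℕ), D ⊆ η.classes ∧ D.Infinite ∧ L = ⋃₀ D

/-- A set is `η`-closed if it is `η`-finite or `η`-infinite. -/
def IsEtaClosed (η : Setoid ℕ) (L : Set ℕ) : Prop :=
  IsEtaFinite η L ∨ IsEtaInfinite η L

/-- The least representatives `a 0 < a 1 < ...` of the `η`-classes, in increasing order.
(Used only when there are infinitely many classes, so that all `a n` are meaningful.) -/
noncomputable def leastRep (η : Setoid ℕ) (n : ℕ) : ℕ :=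
  Nat.nth (fun x => ∀ y, η x y → x ≤ y) n

/-- `A n = [a 0, ..., a (n - 1)]`, the union of the classes of the first `n` least
representatives. -/
def ascendingSet (η : Setoid ℕ) (n : ℕ) : Set ℕ :=
  {x | ∃ m < n, η x (leastRep η m)}

/-- The ascending family for `η`. -/
def ascendingFamily (η : Setoid ℕ) : Set (Set ℕ) :=
  Set.range (ascendingSet η)

/-- An `η`-family is an infinite one-one r.e. class each of whose members is a union of
`η`-classes. -/
def IsEtaFamily (η : Setoid ℕ) (C : Set (Set ℕ)) : Prop :=
  C.Infinite ∧ OneOneRE C ∧ ∀ L ∈ C, IsEtaClosed η L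

/-!
The construction is a Friedberg-style numbering with followers. List `C` as `L 0, L 1, …`, and call
an index redundant if `L i` repeats an earlier set or is some `A n` or `ℕ`. Each `L i` is handed a
sequence of followers, the next one being appointed whenever its redundancy has received further
confirmation; at that moment the previous follower is released, and becomes some `A n` that is so
large that it contains everything enumerated so far, with `n` reserved for this follower alone.
A non-redundant `L i` keeps exactly its last follower, a redundant one keeps none, and the `A n`
that were never reserved are listed separately. The construction works because redundancy is `Π₂`:
being some `A n` is a priori only `Σ₃`, but the `A n` increase to `ℕ`, so that `X` is some `A n` or
`ℕ` iff each `y ∉ X` comes with some `n ≤ y` for which `X = A n`. If `ℕ ∈ C`, it is added at the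
end.
-/

section REPredicates

variable {α β : Type*} [Primcodable α] [Primcodable β]

theorem rePred_comp {p : β → Prop} (hp : REPred p) {f : α → β} (hf : Computable f) :
    REPred fun a => p (f a) :=
  Partrec.comp hp hf

theorem rePred_true : REPred fun _ : α => True :=
  (Computable.const ()).partrec.dom_re.of_eq fun _ => Iff.rfl

theorem rePred_and {p q : α → Prop} (hp : REPred p) (hq : REPred q) :
    REPred fun a => p a ∧ q a :=
  (Partrec.bind hp (Partrec.comp hq Computable.fst).to₂).dom_re.of_eq fun a => by
    simp [Part.assert]

theorem rePred_or {p q : α → Prop} (hp : REPred p) (hq : REPred q) :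
    REPred fun a => p a ∨ q a := by
  obtain ⟨k, hk, hdom⟩ := Partrec.merge' hp hq
  exact hk.dom_re.of_eq fun a => (hdom a).2.trans (by simp [Part.assert])

theorem rePred_exists_nat {q : α → ℕ → Prop} (hq : PrimrecRel q) : REPred fun a => ∃ n, q a n := by
  classical
  have hsearch : Partrec fun a => Nat.rfind fun n => Part.some (decide (q a n)) :=
    Partrec.rfind hq.decide.to_comp.partrec
  refine hsearch.dom_re.of_eq fun a => Nat.rfind_dom.trans ?_
  simp

theorem exists_primrec_stages {p : α → Prop} (hp : REPred p) :
    ∃ q : α → ℕ → Prop, PrimrecRel q ∧ (∀ a, Monotone (q a)) ∧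
      (∀ a s, q a s → Encodable.encode a < s) ∧ ∀ a, p a ↔ ∃ s, q a s := by
  obtain ⟨c, hc⟩ := Nat.Partrec.Code.exists_code.1 hp
  refine ⟨fun a s => (c.evaln s (Encodable.encode a)).isSome, ?_, fun a s t hst h => ?_,
    fun a s h => ?_, fun a => ?_⟩
  · exact Primrec.eq.comp (Primrec.option_isSome.comp (Nat.Partrec.Code.primrec_evaln.comp
      ((Primrec.snd.pair (Primrec.const c)).pair (Primrec.encode.comp Primrec.fst))))
      (Primrec.const true)
  · obtain ⟨v, hv⟩ := Option.isSome_iff_exists.1 h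
    exact Option.isSome_iff_exists.2 ⟨v, Nat.Partrec.Code.evaln_mono hst hv⟩
  · obtain ⟨v, hv⟩ := Option.isSome_iff_exists.1 h
    exact Nat.Partrec.Code.evaln_bound hv
  · have hdom : p a ↔ ∃ v, v ∈ c.eval (Encodable.encode a) := by
      rw [hc]
      simp [Encodable.encodek, Part.mem_assert_iff]
    simp only [hdom, Nat.Partrec.Code.evaln_complete, Option.isSome_iff_exists]
    exact exists_comm

theorem exists_primrec_subsingleton_witness {p : α → Prop} (hp : REPred p) :
    ∃ q : α → ℕ → Prop, PrimrecRel q ∧ (∀ a, {s | q a s}.Subsingleton) ∧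
      ∀ a, p a ↔ ∃ s, q a s := by
  classical
  obtain ⟨q, hq, -, -, hpq⟩ := exists_primrec_stages hp
  refine ⟨fun a s => q a s ∧ ∀ t < s, ¬q a t, ?_, fun a s hs t ht => ?_, fun a => ?_⟩
  · exact hq.and ((hq.swap.not.forall_mem_list.comp (Primrec.list_range.comp Primrec.snd)
      Primrec.fst).of_eq fun z => by simp)
  · exact le_antisymm (not_lt.1 fun h => hs.2 t h ht.1) (not_lt.1 fun h => ht.2 s h hs.1)
  · rw [hpq]
    exact ⟨fun h => ⟨Nat.find h, Nat.find_spec h, fun t ht => Nat.find_min h ht⟩,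
      fun ⟨s, hs, _⟩ => ⟨s, hs⟩⟩

theorem rePred_exists {p : α × β → Prop} (hp : REPred p) : REPred fun a => ∃ b, p (a, b) := by
  obtain ⟨q, hq, -, -, hpq⟩ := exists_primrec_stages hp
  have hq' : PrimrecRel fun (w : β × ℕ) (a : α) => q (a, w.1) w.2 :=
    hq.comp (Primrec.snd.pair (Primrec.fst.comp Primrec.fst)) (Primrec.snd.comp Primrec.fst)
  have hdecode : PrimrecRel fun (a : α) (n : ℕ) =>
      ∃ w ∈ (Encodable.decode (α := β × ℕ) n).toList, q (a, w.1) w.2 :=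
    hq'.exists_mem_list.comp
      (Primrec.optionToList.comp (Primrec.decode.comp Primrec.snd)) Primrec.fst
  refine (rePred_exists_nat hdecode).of_eq fun a => ?_
  simp only [Option.mem_toList, hpq]
  constructor
  · rintro ⟨_, w, -, hw⟩
    exact ⟨w.1, w.2, hw⟩
  · rintro ⟨b, s, hs⟩
    exact ⟨Encodable.encode (b, s), (b, s), Encodable.encodek _, hs⟩

theorem rePred_forall_lt {p : α × ℕ → Prop} (hp : REPred p) :
    REPred fun z : α × ℕ => ∀ n < z.2, p (z.1, n) := by
  obtain ⟨q, hq, hmono, -, hpq⟩ := exists_primrec_stages hp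
  have hq' : PrimrecRel fun (n : ℕ) (w : α × ℕ) => q (w.1, n) w.2 :=
    hq.comp ((Primrec.fst.comp Primrec.snd).pair Primrec.fst) (Primrec.snd.comp Primrec.snd)
  have hbounded : PrimrecRel fun (z : α × ℕ) (s : ℕ) => ∀ n < z.2, q (z.1, n) s :=
    (hq'.forall_mem_list.comp (Primrec.list_range.comp (Primrec.snd.comp Primrec.fst))
      ((Primrec.fst.comp Primrec.fst).pair Primrec.snd)).of_eq fun z => by simp
  refine (rePred_exists_nat hbounded).of_eq fun z => ⟨fun ⟨s, hs⟩ n hn => ?_, fun h => ?_⟩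
  · exact (hpq _).2 ⟨s, hs n hn⟩
  · refine ((Filter.eventually_all_finite (l := Filter.atTop) (Set.finite_lt_nat z.2)).2
      fun n hn => ?_).exists
    obtain ⟨s, hs⟩ := (hpq _).1 (h n hn)
    exact Filter.eventually_atTop.2 ⟨s, fun t hst => hmono _ hst hs⟩

theorem rePred_mem_image {f : α → β} (hf : Computable f) {K : Set α} (hK : REPred (· ∈ K)) :
    REPred (· ∈ f '' K) := by
  have hgraph : REPred fun z : β × α => z.2 ∈ K ∧ f z.2 = z.1 := rePred_and
    (rePred_comp hK Computable.snd)
    (rePred_comp (p := fun z : β × β => z.1 = z.2) Primrec.eq.computablePred.to_re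
      ((hf.comp Computable.snd).pair Computable.fst))
  exact rePred_exists hgraph

theorem rePred_notMem_image_encode {S : Set α} (hS : PrimrecPred (· ∈ S)) :
    REPred (· ∉ Encodable.encode '' S) := by
  have hcode : PrimrecRel fun (a : α) (n : ℕ) => a ∈ S ∧ Encodable.encode a = n :=
    (hS.comp Primrec.fst).and (Primrec.eq.comp (Primrec.encode.comp Primrec.fst) Primrec.snd)
  have hdecode : REPred fun n => ∀ a ∈ (Encodable.decode (α := α) n).toList,
      ¬(a ∈ S ∧ Encodable.encode a = n) :=
    (hcode.not.forall_mem_list.comp (Primrec.optionToList.comp Primrec.decode)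
      Primrec.id).computablePred.to_re
  refine hdecode.of_eq fun n => ⟨?_, fun h a _ ha => h ⟨a, ha⟩⟩
  rintro h ⟨a, ha, rfl⟩
  exact h a (by simp) ⟨ha, rfl⟩

end REPredicates

section IsPi2

variable {α : Type*} [Primcodable α]

/-- A `Π₂` predicate, presented as `∀ n, q (a, n)` with `q` recursively enumerable. -/
def IsPi2 (p : α → Prop) : Prop :=
  ∃ q : α × ℕ → Prop, REPred q ∧ ∀ a, p a ↔ ∀ n, q (a, n)

namespace IsPi2

variable {p p' : α → Prop}

theorem of_rePred (hp : REPred p) : IsPi2 p :=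
  ⟨fun z => p z.1, rePred_comp hp Computable.fst, by simp⟩

theorem comp {β : Type*} [Primcodable β] (hp : IsPi2 p) {f : β → α} (hf : Computable f) :
    IsPi2 fun b => p (f b) := by
  obtain ⟨q, hq, hpq⟩ := hp
  exact ⟨fun z => q (f z.1, z.2), rePred_comp hq ((hf.comp Computable.fst).pair Computable.snd),
    fun b => hpq (f b)⟩

theorem and (hp : IsPi2 p) (hp' : IsPi2 p') : IsPi2 fun a => p a ∧ p' a := by
  obtain ⟨q, hq, hpq⟩ := hp
  obtain ⟨q', hq', hpq'⟩ := hp'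
  exact ⟨fun z => q z ∧ q' z, rePred_and hq hq', fun a => by
    simp only [hpq, hpq', forall_and]⟩

theorem forall_nat {p : α × ℕ → Prop} (hp : IsPi2 p) : IsPi2 fun a => ∀ n, p (a, n) := by
  obtain ⟨q, hq, hpq⟩ := hp
  refine ⟨fun z => q ((z.1, z.2.unpair.1), z.2.unpair.2), rePred_comp hq ?_, fun a => ?_⟩
  · have hunpair : Computable fun z : α × ℕ => z.2.unpair :=
      Computable.unpair.comp Computable.snd
    exact (Computable.fst.pair (Computable.fst.comp hunpair)).pair (Computable.snd.comp hunpair)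
  · simp only [hpq]
    exact ⟨fun h _ => h _ _, fun h m n => by simpa using h (Nat.pair m n)⟩

theorem or (hp : IsPi2 p) (hp' : IsPi2 p') : IsPi2 fun a => p a ∨ p' a := by
  obtain ⟨q, hq, hpq⟩ := hp
  obtain ⟨q', hq', hpq'⟩ := hp'
  have hor : REPred fun z : (α × ℕ) × ℕ => q (z.1.1, z.2) ∨ q' z.1 :=
    rePred_or (rePred_comp hq ((Computable.fst.comp Computable.fst).pair Computable.snd))
      (rePred_comp hq' Computable.fst)
  simpa only [hpq, hpq', ← forall_or_left, ← forall_or_right] using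
    forall_nat ⟨_, hor, fun _ => Iff.rfl⟩

theorem exists_antitone (hp : IsPi2 p) :
    ∃ q : α × ℕ → Prop, REPred q ∧ (∀ a, Antitone fun n => q (a, n)) ∧ (∀ a, q (a, 0)) ∧
      ∀ a, p a ↔ ∀ n, q (a, n) := by
  obtain ⟨q, hq, hpq⟩ := hp
  refine ⟨fun z => ∀ m < z.2, q (z.1, m), rePred_forall_lt hq,
    fun a m n hmn h k hk => h k (hk.trans_le hmn), fun a m hm => absurd hm m.not_lt_zero,
    fun a => ?_⟩
  rw [hpq]
  exact ⟨fun h _ m _ => h m, fun h n => h (n + 1) n n.lt_succ_self⟩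

theorem exists_lt {p : α × ℕ → Prop} (hp : IsPi2 p) :
    IsPi2 fun z : α × ℕ => ∃ m < z.2, p (z.1, m) := by
  obtain ⟨q, hq, hanti, -, hpq⟩ := hp.exists_antitone
  have hwitness : REPred fun z : ((α × ℕ) × ℕ) × ℕ =>
      z.2 < z.1.1.2 ∧ q ((z.1.1.1, z.2), z.1.2) := by
    have harg := Computable.fst.comp (Computable.fst (α := (α × ℕ) × ℕ) (β := ℕ))
    refine rePred_and (Primrec.nat_lt.comp Primrec.snd (Primrec.snd.comp
      (Primrec.fst.comp Primrec.fst))).computablePred.to_re (rePred_comp hq ?_)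
    exact ((Computable.fst.comp harg).pair Computable.snd).pair
      (Computable.snd.comp Computable.fst)
  refine ⟨_, rePred_exists hwitness, fun z => ⟨fun ⟨m, hm, h⟩ n => ⟨m, hm, (hpq _).1 h n⟩,
    fun h => ?_⟩⟩
  -- Each `m < z.2` that fails does so from some point on, hence all of them fail at once.
  by_contra! hfail
  refine ((Filter.eventually_all_finite (l := Filter.atTop) (Set.finite_lt_nat z.2)
    (p := fun m n => ¬q ((z.1, m), n))).2 fun m hm => ?_).exists.elim fun n hn =>
      (h n).elim fun m ⟨hm, hq⟩ => hn m hm hq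
  obtain ⟨n, hn⟩ := not_forall.1 fun hall => hfail m hm ((hpq _).2 hall)
  exact Filter.eventually_atTop.2 ⟨n, fun k hk hq => hn (hanti _ hk hq)⟩

end IsPi2

end IsPi2

section REFamilies

variable {α : Type*} [Primcodable α] {X Y : α → Set ℕ}

/-- A uniformly recursively enumerable family of sets, with the parametrization as part of the
data. -/
def IsREFamily (X : α → Set ℕ) : Prop :=
  REPred fun z : α × ℕ => z.2 ∈ X z.1

theorem isREFamily_W : IsREFamily W :=
  (Nat.Partrec.Code.eval_part.comp ((Computable.ofNat _).comp Computable.fst)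
    Computable.snd).dom_re

theorem IsREFamily.rePred_mem {β : Type*} [Primcodable β] (hX : IsREFamily X) {f : β → α}
    {g : β → ℕ} (hf : Computable f) (hg : Computable g) : REPred fun b => g b ∈ X (f b) :=
  rePred_comp hX (hf.pair hg)

theorem IsREFamily.exists_computable_index (hX : IsREFamily X) :
    ∃ f : α → ℕ, Computable f ∧ W ∘ f = X := by
  obtain ⟨c, hc⟩ := Nat.Partrec.Code.exists_code.1 hX
  refine ⟨fun a => Encodable.encode (c.curry (Encodable.encode a)),
    (Primrec.encode.comp (Nat.Partrec.Code.primrec₂_curry.comp (Primrec.const c)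
      Primrec.encode)).to_comp, ?_⟩
  ext a x
  have hpair : Nat.pair (Encodable.encode a) x = Encodable.encode (a, x) := rfl
  simp only [W, Function.comp_apply, Set.mem_ofPred_eq, Denumerable.ofNat_encode,
    Nat.Partrec.Code.eval_curry, hc, hpair]
  simp [Part.assert]

theorem exists_W_eq {V : Set ℕ} (hV : REPred (· ∈ V)) : ∃ e, W e = V := by
  have hconst : IsREFamily fun _ : Unit => V := rePred_comp hV Computable.snd
  obtain ⟨f, -, hf⟩ := hconst.exists_computable_index
  exact ⟨f (), congrFun hf ()⟩

theorem IsREFamily.isPi2_subset (hX : IsREFamily X) (hY : IsREFamily Y) :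
    IsPi2 fun a => X a ⊆ Y a := by
  obtain ⟨T, hT, -, -, hTX⟩ := exists_primrec_stages hX
  have himp : REPred fun w : (α × ℕ) × ℕ => ¬T w.1 w.2 ∨ w.1.2 ∈ Y w.1.1 :=
    rePred_or (PrimrecPred.not hT).computablePred.to_re (rePred_comp hY Computable.fst)
  have hall : IsPi2 fun z : α × ℕ => z.2 ∈ X z.1 → z.2 ∈ Y z.1 :=
    ⟨_, himp, fun z => by simp only [hTX z, exists_imp, ← imp_iff_not_or]⟩
  exact hall.forall_nat

theorem IsREFamily.isPi2_eq (hX : IsREFamily X) (hY : IsREFamily Y) :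
    IsPi2 fun a => X a = Y a := by
  simpa only [Set.Subset.antisymm_iff] using (hX.isPi2_subset hY).and (hY.isPi2_subset hX)

theorem IsREFamily.uniformlyRE_range (hX : IsREFamily X) : UniformlyRE (Set.range X) := by
  obtain ⟨f, hf, rfl⟩ := hX.exists_computable_index
  have huniv : REPred (· ∈ (Set.univ : Set α)) := rePred_true
  exact ⟨f '' Set.univ, rePred_mem_image hf huniv, by rw [Set.image_univ, Set.range_comp]⟩

theorem UniformlyRE.exists_range_eq {C : Set (Set ℕ)} (hC : UniformlyRE C) (hempty : ∅ ∈ C) :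
    ∃ L : ℕ → Set ℕ, IsREFamily L ∧ Set.range L = C := by
  obtain ⟨S, hS, rfl⟩ := hC
  refine ⟨fun i => {x | i ∈ S ∧ x ∈ W i}, rePred_and (rePred_comp hS Computable.fst) isREFamily_W,
    Set.Subset.antisymm ?_ ?_⟩
  · rintro _ ⟨i, rfl⟩
    by_cases hi : i ∈ S
    · exact ⟨i, hi, by simp [hi]⟩
    · simpa [hi] using hempty
  · rintro _ ⟨i, hi, rfl⟩
    exact ⟨i, by simp [hi]⟩

end REFamilies

namespace OneOneRE

theorem image_of_injOn {α : Type*} [Primcodable α] {X : α → Set ℕ} {K : Set α}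
    (hX : IsREFamily X) (hK : REPred (· ∈ K)) (hinj : Set.InjOn X K) : OneOneRE (X '' K) := by
  obtain ⟨f, hf, rfl⟩ := hX.exists_computable_index
  exact ⟨f '' K, rePred_mem_image hf hK, Set.image_comp W f K, hinj.image_of_comp⟩

theorem union {C D : Set (Set ℕ)} (hC : OneOneRE C) (hD : OneOneRE D) (hCD : Disjoint C D) :
    OneOneRE (C ∪ D) := by
  obtain ⟨S, hS, rfl, hinjS⟩ := hC
  obtain ⟨S', hS', rfl, hinjS'⟩ := hD
  refine ⟨S ∪ S', rePred_or hS hS', (Set.image_union ..).symm, ?_⟩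
  have hne : ∀ i ∈ S, ∀ j ∈ S', W i ≠ W j := fun i hi j hj =>
    hCD.ne_of_mem (Set.mem_image_of_mem W hi) (Set.mem_image_of_mem W hj)
  have hSS' : Disjoint S S' := Set.disjoint_left.2 fun i hi hi' => hne i hi i hi' rfl
  exact (Set.injOn_union hSS').2 ⟨hinjS, hinjS', hne⟩

theorem insert {C : Set (Set ℕ)} (hC : OneOneRE C) {V : Set ℕ} (hV : REPred (· ∈ V)) :
    OneOneRE (insert V C) := by
  by_cases hVC : V ∈ C
  · rwa [Set.insert_eq_of_mem hVC]
  obtain ⟨e, rfl⟩ := exists_W_eq hV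
  have hsingleton : OneOneRE {W e} :=
    ⟨{e}, (Primrec.eq.comp Primrec.id (Primrec.const e)).computablePred.to_re,
      Set.image_singleton.symm, Set.injOn_singleton W e⟩
  rw [Set.insert_eq]
  exact hsingleton.union hC (Set.disjoint_singleton_left.2 hVC)

end OneOneRE

section Followers

theorem IsREFamily.exists_switch {α : Type*} [Primcodable α] {X : α → Set ℕ}
    {Y : α × ℕ → Set ℕ} {R : α → ℕ → Prop} (hX : IsREFamily X) (hY : IsREFamily Y)
    (hIio : ∀ a t, Set.Iio t ⊆ Y (a, t)) (hR : PrimrecRel R)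
    (hunique : ∀ a, {t | R a t}.Subsingleton) :
    ∃ F : α → Set ℕ, IsREFamily F ∧ (∀ a, (∀ t, ¬R a t) → F a = X a) ∧
      ∀ a t, R a t → F a = Y (a, t) := by
  obtain ⟨T, hT, -, hTlt, hTX⟩ := exists_primrec_stages hX
  -- Elements of `X a` enumerated by stage `s` are kept only if no switch occurs by then; such a
  -- switch can only happen at a stage `t > s`, and the set it switches to contains them.
  refine ⟨fun a => {x | (∃ s, T (a, x) s ∧ ∀ t < s, ¬R a t) ∨ ∃ t, R a t ∧ x ∈ Y (a, t)},
    rePred_or ?_ ?_, fun a ha => ?_, fun a t hat => ?_⟩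
  · have hpending : REPred fun w : (α × ℕ) × ℕ => T w.1 w.2 ∧ ∀ t < w.2, ¬R w.1.1 t :=
      rePred_and hT.computablePred.to_re (rePred_comp (rePred_forall_lt
        (PrimrecPred.not hR).computablePred.to_re)
          ((Computable.fst.comp Computable.fst).pair Computable.snd))
    exact rePred_exists hpending
  · have hswitched : REPred fun w : (α × ℕ) × ℕ => R w.1.1 w.2 ∧ w.1.2 ∈ Y (w.1.1, w.2) := by
      have harg : Computable fun w : (α × ℕ) × ℕ => (w.1.1, w.2) :=
        (Computable.fst.comp Computable.fst).pair Computable.snd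
      exact rePred_and (rePred_comp hR.computablePred.to_re harg)
        (hY.rePred_mem harg (Computable.snd.comp Computable.fst))
    exact rePred_exists hswitched
  · ext x
    simp [ha, hTX (a, x)]
  · ext x
    constructor
    · rintro (⟨s, hs, hpending⟩ | ⟨t', ht', hx⟩)
      · have hxs : x < s := (Nat.right_le_pair _ _).trans_lt (hTlt _ _ hs)
        exact hIio a t (hxs.trans_le (not_lt.1 fun hts => hpending t hts hat))
      · rwa [hunique a hat ht']
    · exact fun hx => Or.inr ⟨t, hat, hx⟩

theorem IsREFamily.exists_release {α : Type*} [Primcodable α] {X : α → Set ℕ} {A : ℕ → Set ℕ}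
    {D : Set α} (hX : IsREFamily X) (hA : IsREFamily A) (hIio : ∀ n, Set.Iio n ⊆ A n)
    (hD : REPred (· ∈ D)) :
    ∃ (F : α → Set ℕ) (m : α → ℕ), IsREFamily F ∧ (∀ a ∉ D, F a = X a) ∧
      (∀ a ∈ D, F a = A (m a)) ∧ Set.InjOn m D ∧ REPred (· ∉ m '' D) := by
  classical
  obtain ⟨R, hR, hunique, hDR⟩ := exists_primrec_subsingleton_witness hD
  have hY : IsREFamily fun w : α × ℕ => A (Encodable.encode w) :=
    hA.rePred_mem (Computable.encode.comp Computable.fst) Computable.snd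
  have hle : ∀ (a : α) (t : ℕ), t ≤ Encodable.encode (a, t) := fun a t =>
    Nat.right_le_pair (Encodable.encode a) (Encodable.encode t)
  have hIioY : ∀ a t, Set.Iio t ⊆ A (Encodable.encode (a, t)) := fun a t =>
    (Set.Iio_subset_Iio (hle a t)).trans (hIio _)
  obtain ⟨F, hF, hFX, hFY⟩ := hX.exists_switch hY hIioY hR hunique
  choose! t ht using fun a => (hDR a).1
  refine ⟨F, fun a => Encodable.encode (a, t a), hF,
    fun a ha => hFX a fun s hs => ha ((hDR a).2 ⟨s, hs⟩), fun a ha => hFY a _ (ht a ha),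
    fun a _ b _ hab => congrArg Prod.fst (Encodable.encode_injective hab), ?_⟩
  have hcodes : (fun a => Encodable.encode (a, t a)) '' D =
      Encodable.encode '' {w : α × ℕ | R w.1 w.2} := by
    refine Set.Subset.antisymm ?_ ?_
    · rintro _ ⟨a, ha, rfl⟩
      exact ⟨(a, t a), ht a ha, rfl⟩
    · rintro _ ⟨⟨a, s⟩, hs, rfl⟩
      have ha : a ∈ D := (hDR a).2 ⟨s, hs⟩
      obtain rfl : t a = s := hunique a (ht a ha) hs
      exact ⟨a, ha, rfl⟩
  rw [hcodes]
  exact rePred_notMem_image_encode hR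

theorem oneOneRE_image_diff_union_range {α : Type*} [Primcodable α] {X : α → Set ℕ}
    {A : ℕ → Set ℕ} {K D : Set α} (hX : IsREFamily X) (hK : REPred (· ∈ K)) (hD : REPred (· ∈ D))
    (hXinj : Set.InjOn X (K \ D)) (hA : IsREFamily A) (hAinj : Function.Injective A)
    (hIio : ∀ n, Set.Iio n ⊆ A n) (hdisj : Disjoint (X '' (K \ D)) (Set.range A)) :
    OneOneRE (X '' (K \ D) ∪ Set.range A) := by
  obtain ⟨F, m, hF, hFX, hFA, hminj, hm⟩ := hX.exists_release hA hIio hD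
  have himage_diff : F '' (K \ D) = X '' (K \ D) := Set.image_congr fun a ha => hFX a ha.2
  have himage : F '' D = A '' (m '' D) := by
    rw [Set.image_image]
    exact Set.image_congr hFA
  have hinj_diff : Set.InjOn F (K \ D) := hXinj.congr fun a ha => (hFX a ha.2).symm
  have hinj : Set.InjOn F D := (hAinj.comp_injOn hminj).congr fun a ha => (hFA a ha).symm
  have hdisj_range : ∀ {S : Set ℕ}, Disjoint (X '' (K \ D)) (A '' S) := fun {S} =>
    hdisj.mono_right (Set.image_subset_range A S)
  have hinj_union : Set.InjOn F (K \ D ∪ D) :=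
    (Set.injOn_union Set.disjoint_sdiff_left).2 ⟨hinj_diff, hinj, fun a ha b hb => by
      rw [hFX a ha.2, hFA b hb]
      exact hdisj.ne_of_mem (Set.mem_image_of_mem X ha) (Set.mem_range_self _)⟩
  have hvalues : F '' (K \ D ∪ D) = X '' (K \ D) ∪ A '' (m '' D) := by
    rw [Set.image_union, himage_diff, himage]
  have hreleased : OneOneRE (F '' (K \ D ∪ D)) := by
    rw [Set.sdiff_union_self] at hinj_union ⊢
    exact .image_of_injOn hF (rePred_or hK hD) hinj_union
  have hunused : OneOneRE (A '' (m '' D)ᶜ) := .image_of_injOn hA hm hAinj.injOn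
  rw [hvalues] at hreleased
  have hresult := hreleased.union hunused (Set.disjoint_union_left.2
    ⟨hdisj_range, (Set.disjoint_image_iff hAinj).2 disjoint_compl_right⟩)
  rwa [Set.union_assoc, ← Set.image_union, Set.union_compl_self, Set.image_univ] at hresult

theorem oneOneRE_image_not_union_range {α : Type*} [Primcodable α] {P : α → Prop} {L : α → Set ℕ}
    {A : ℕ → Set ℕ} (hP : IsPi2 P) (hL : IsREFamily L) (hLinj : Set.InjOn L {a | ¬P a})
    (hA : IsREFamily A) (hAinj : Function.Injective A) (hIio : ∀ n, Set.Iio n ⊆ A n)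
    (hdisj : Disjoint (L '' {a | ¬P a}) (Set.range A)) :
    OneOneRE (L '' {a | ¬P a} ∪ Set.range A) := by
  obtain ⟨q, hq, hanti, hq0, hPq⟩ := hP.exists_antitone
  -- The follower `(a, r)` of `L a` is appointed if `q (a, r)` and released if `q (a, r + 1)`, so
  -- that `L a` keeps exactly one follower if `¬P a`, and none if `P a`.
  have hreleased : REPred (· ∈ {z : α × ℕ | q (z.1, z.2 + 1)}) :=
    rePred_comp hq (Computable.fst.pair (Computable.succ.comp Computable.snd))
  have hX : IsREFamily fun z : α × ℕ => L z.1 :=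
    hL.rePred_mem (Computable.fst.comp Computable.fst) Computable.snd
  have hnot : ∀ {z : α × ℕ}, ¬q (z.1, z.2 + 1) → ¬P z.1 := fun hz h => hz ((hPq _).1 h _)
  have hkept : L '' {a | ¬P a} =
      (fun z : α × ℕ => L z.1) '' ({z | q z} \ {z | q (z.1, z.2 + 1)}) := by
    refine Set.Subset.antisymm ?_ ?_
    · rintro _ ⟨a, ha, rfl⟩
      have hlast : ∃ r, q (a, r) ∧ ¬q (a, r + 1) := by
        by_contra! hsucc
        exact ha ((hPq a).2 fun n => Nat.rec (hq0 a) hsucc n)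
      exact hlast.elim fun r hr => ⟨(a, r), hr, rfl⟩
    · rintro _ ⟨z, hz, rfl⟩
      exact ⟨z.1, hnot hz.2, rfl⟩
  rw [hkept] at hdisj ⊢
  refine oneOneRE_image_diff_union_range hX hq hreleased ?_ hA hAinj hIio hdisj
  rintro ⟨a, r⟩ hr ⟨b, s⟩ hs hab
  obtain rfl : a = b := hLinj (hnot hr.2) (hnot hs.2) hab
  have hle : ∀ {k l}, q (a, k) → ¬q (a, l + 1) → k ≤ l := fun hk hl =>
    not_lt.1 fun hlk => hl (hanti a hlk hk)
  rw [le_antisymm (hle hr.1 hs.2) (hle hs.1 hr.2)]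

end Followers

section Redundancy

variable {L A : ℕ → Set ℕ}

/-- The index `i` is redundant if `L i` already has a smaller index, is listed by `A`, or is the
whole of `ℕ`. The last clause is what makes redundancy a `Π₂` property. -/
def IsRedundant (L A : ℕ → Set ℕ) (i : ℕ) : Prop :=
  (∃ j < i, L j = L i) ∨ L i ∈ insert Set.univ (Set.range A)

-- Sets `A n ⊇ [0, n)` can only accumulate at `ℕ`: if `y ∉ A n` then `n ≤ y`.
theorem mem_insert_univ_range_iff (hIio : ∀ n, Set.Iio n ⊆ A n) {X : Set ℕ} :
    X ∈ insert Set.univ (Set.range A) ↔ ∀ y, y ∈ X ∨ ∃ n < y + 1, A n = X := by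
  constructor
  · rintro (rfl | ⟨n, rfl⟩) y
    · exact Or.inl trivial
    · refine or_iff_not_imp_left.2 fun hy => ⟨n, Nat.lt_succ_iff.2 ?_, rfl⟩
      exact not_lt.1 fun hyn => hy (hIio n hyn)
  · intro h
    by_cases hX : X = Set.univ
    · exact Or.inl hX
    · obtain ⟨y, hy⟩ := (Set.ne_univ_iff_exists_notMem X).1 hX
      obtain ⟨n, -, hn⟩ := (h y).resolve_left hy
      exact Or.inr ⟨n, hn⟩

theorem isPi2_isRedundant (hL : IsREFamily L) (hA : IsREFamily A)
    (hIio : ∀ n, Set.Iio n ⊆ A n) : IsPi2 (IsRedundant L A) := by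
  have heq : ∀ {B : ℕ → Set ℕ}, IsREFamily B → IsPi2 fun z : ℕ × ℕ => B z.2 = L z.1 :=
    fun hB => IsREFamily.isPi2_eq
      (hB.rePred_mem (Computable.snd.comp Computable.fst) Computable.snd)
      (hL.rePred_mem (Computable.fst.comp Computable.fst) Computable.snd)
  have hrepeated : IsPi2 fun i => ∃ j < i, L j = L i :=
    (heq hL).exists_lt.comp (Computable.id.pair Computable.id)
  have hlisted : IsPi2 fun z : ℕ × ℕ => z.2 ∈ L z.1 ∨ ∃ n < z.2 + 1, A n = L z.1 :=
    (IsPi2.of_rePred hL).or ((heq hA).exists_lt.comp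
      (Computable.fst.pair (Computable.succ.comp Computable.snd)))
  unfold IsRedundant
  simpa only [mem_insert_univ_range_iff hIio] using hrepeated.or hlisted.forall_nat

theorem injOn_not_isRedundant : Set.InjOn L {i | ¬IsRedundant L A i} := fun i hi j hj hij =>
  le_antisymm (not_lt.1 fun h => hi (Or.inl ⟨j, h, hij.symm⟩))
    (not_lt.1 fun h => hj (Or.inl ⟨i, h, hij⟩))

theorem disjoint_image_not_isRedundant :
    Disjoint (L '' {i | ¬IsRedundant L A i}) (insert Set.univ (Set.range A)) := by
  rw [Set.disjoint_left]
  rintro _ ⟨i, hi, rfl⟩ hLi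
  exact hi (Or.inr hLi)

theorem insert_univ_image_not_isRedundant_union_range (hAL : Set.range A ⊆ Set.range L) :
    insert Set.univ (L '' {i | ¬IsRedundant L A i} ∪ Set.range A) =
      insert Set.univ (Set.range L) := by
  classical
  refine Set.Subset.antisymm
    (Set.insert_subset_insert (Set.union_subset (Set.image_subset_range ..) hAL)) ?_
  refine Set.insert_subset (Set.mem_insert ..) ?_
  intro X hX
  by_cases hmem : X ∈ insert Set.univ (Set.range A)
  · exact Set.insert_subset_insert Set.subset_union_right hmem
  · refine Or.inr (Or.inl ⟨Nat.find hX, ?_, Nat.find_spec hX⟩)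
    rintro (⟨j, hj, hjX⟩ | hmem')
    · exact Nat.find_min hX hj (hjX.trans (Nat.find_spec hX))
    · rw [Nat.find_spec hX] at hmem'
      exact hmem hmem'

end Redundancy

theorem oneOneRE_range_of_range_subset {L A : ℕ → Set ℕ} (hL : IsREFamily L) (hA : IsREFamily A)
    (hAinj : Function.Injective A) (hIio : ∀ n, Set.Iio n ⊆ A n)
    (hAL : Set.range A ⊆ Set.range L) : OneOneRE (Set.range L) := by
  have hcore := oneOneRE_image_not_union_range (isPi2_isRedundant hL hA hIio) hL
    injOn_not_isRedundant hA hAinj hIio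
    (disjoint_image_not_isRedundant.mono_right (Set.subset_insert ..))
  have hinsert := insert_univ_image_not_isRedundant_union_range hAL
  by_cases huniv : Set.univ ∈ Set.range L
  · rw [← Set.insert_eq_of_mem huniv, ← hinsert]
    exact hcore.insert rePred_true
  · have huniv' : Set.univ ∉ L '' {i | ¬IsRedundant L A i} ∪ Set.range A := fun h =>
      huniv (Set.union_subset (Set.image_subset_range ..) hAL h)
    rwa [← Set.insert_sdiff_self_of_notMem huniv, ← hinsert,
      Set.insert_sdiff_self_of_notMem huniv']

section Saturation

variable {η : Setoid ℕ}

/-- The union of the `η`-classes that meet `X`, that is, the least union of classes containing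
`X`. -/
def etaSaturation (η : Setoid ℕ) (X : Set ℕ) : Set ℕ :=
  {x | ∃ y, η x y ∧ y ∈ X}

theorem etaSaturation_eq_sUnion (η : Setoid ℕ) (X : Set ℕ) :
    etaSaturation η X = ⋃₀ ((fun y => {x | η x y}) '' X) := by
  ext x
  simp [etaSaturation, and_comm]

theorem image_class_subset_classes (η : Setoid ℕ) (X : Set ℕ) :
    (fun y => {x | η x y}) '' X ⊆ η.classes :=
  Set.image_subset_iff.2 fun y _ => Setoid.mem_classes η y

theorem isEtaClosed_etaSaturation (η : Setoid ℕ) (X : Set ℕ) :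
    IsEtaClosed η (etaSaturation η X) :=
  (Set.finite_or_infinite ((fun y => {x | η x y}) '' X)).imp
    (fun h => ⟨_, image_class_subset_classes η X, h, etaSaturation_eq_sUnion η X⟩)
    fun h => ⟨_, image_class_subset_classes η X, h, etaSaturation_eq_sUnion η X⟩

theorem isEtaFinite_etaSaturation (η : Setoid ℕ) {X : Set ℕ} (hX : X.Finite) :
    IsEtaFinite η (etaSaturation η X) :=
  ⟨_, image_class_subset_classes η X, hX.image _, etaSaturation_eq_sUnion η X⟩

theorem etaSaturation_sUnion {D : Set (Set ℕ)} (hD : D ⊆ η.classes) :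
    etaSaturation η (⋃₀ D) = ⋃₀ D := by
  ext x
  constructor
  · rintro ⟨y, hxy, c, hc, hy⟩
    obtain ⟨z, rfl⟩ := hD hc
    exact ⟨_, hc, η.trans hxy hy⟩
  · exact fun hx => ⟨x, η.refl x, hx⟩

theorem IsEtaClosed.etaSaturation_eq {X : Set ℕ} (hX : IsEtaClosed η X) :
    etaSaturation η X = X := by
  obtain ⟨D, hD, -, rfl⟩ | ⟨D, hD, -, rfl⟩ := hX <;> exact etaSaturation_sUnion hD

theorem IsEtaFinite.exists_list {X : Set ℕ} (hX : IsEtaFinite η X) :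
    ∃ l : List ℕ, etaSaturation η {x | x ∈ l} = X := by
  obtain ⟨D, hD, hfin, rfl⟩ := hX
  choose! rep hrep using hD
  refine ⟨hfin.toFinset.toList.map rep, ?_⟩
  have hclasses : (fun y => {x | η x y}) '' {x | x ∈ hfin.toFinset.toList.map rep} = D := by
    have hmem : {x | x ∈ hfin.toFinset.toList.map rep} = rep '' D := by
      ext x
      simp
    rw [hmem, Set.image_image]
    exact (Set.image_congr fun c hc => (hrep hc).symm).trans (Set.image_id' D)
  rw [etaSaturation_eq_sUnion, hclasses]

theorem IsREFamily.etaSaturation {α : Type*} [Primcodable α] {X : α → Set ℕ}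
    (hη : IsPositive η) (hX : IsREFamily X) : IsREFamily fun a => etaSaturation η (X a) := by
  have hrel : REPred fun w : (α × ℕ) × ℕ => η w.1.2 w.2 ∧ w.2 ∈ X w.1.1 :=
    rePred_and (rePred_comp hη ((Computable.snd.comp Computable.fst).pair Computable.snd))
      (hX.rePred_mem (Computable.fst.comp Computable.fst) Computable.snd)
  exact rePred_exists hrel

theorem isREFamily_etaSaturation_list (hη : IsPositive η) :
    IsREFamily fun l : List ℕ => etaSaturation η {x | x ∈ l} := by
  have hmem : PrimrecRel fun (l : List ℕ) (x : ℕ) => ∃ y ∈ l, y = x :=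
    Primrec.eq.exists_mem_list
  have hlist : IsREFamily fun l : List ℕ => {x | x ∈ l} :=
    hmem.computablePred.to_re.of_eq fun z => by simp
  exact hlist.etaSaturation hη

end Saturation

section Ascending

variable {η : Setoid ℕ}

theorem exists_least_rel (η : Setoid ℕ) (x : ℕ) : ∃ r ≤ x, η x r ∧ ∀ y, η r y → r ≤ y := by
  classical
  have h : ∃ r, η x r := ⟨x, η.refl x⟩
  exact ⟨Nat.find h, Nat.find_min' h (η.refl x), Nat.find_spec h,
    fun y hy => Nat.find_min' h (η.trans (Nat.find_spec h) hy)⟩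

theorem infinite_setOf_least_rel (hinf : η.classes.Infinite) :
    {x | ∀ y, η x y → x ≤ y}.Infinite := by
  intro hfin
  refine hinf ((hfin.image fun r => {x | η x r}).subset ?_)
  rintro _ ⟨x, rfl⟩
  obtain ⟨r, -, hxr, hr⟩ := exists_least_rel η x
  exact ⟨r, hr, Set.ext fun z => ⟨fun h => η.trans h (η.symm hxr), fun h => η.trans h hxr⟩⟩

theorem leastRep_le_of_rel (hinf : η.classes.Infinite) {n y : ℕ} (h : η (leastRep η n) y) :
    leastRep η n ≤ y :=
  Nat.nth_mem_of_infinite (infinite_setOf_least_rel hinf) n y h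

theorem leastRep_strictMono (hinf : η.classes.Infinite) : StrictMono (leastRep η) :=
  Nat.nth_strictMono (infinite_setOf_least_rel hinf)

theorem eq_of_leastRep_rel (hinf : η.classes.Infinite) {m n : ℕ}
    (h : η (leastRep η m) (leastRep η n)) : m = n :=
  (leastRep_strictMono hinf).injective
    (le_antisymm (leastRep_le_of_rel hinf h) (leastRep_le_of_rel hinf (η.symm h)))

theorem exists_rel_leastRep (η : Setoid ℕ) (x : ℕ) :
    ∃ m, η x (leastRep η m) ∧ leastRep η m ≤ x := by
  classical
  obtain ⟨r, hrx, hxr, hr⟩ := exists_least_rel η x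
  have h : leastRep η (Nat.count (fun x => ∀ y, η x y → x ≤ y) r) = r := Nat.nth_count hr
  exact ⟨_, by rwa [h], by rwa [h]⟩

theorem leastRep_mem_ascendingSet_iff (hinf : η.classes.Infinite) {m n : ℕ} :
    leastRep η m ∈ ascendingSet η n ↔ m < n := by
  constructor
  · rintro ⟨k, hk, h⟩
    rwa [eq_of_leastRep_rel hinf h]
  · exact fun h => ⟨m, h, η.refl _⟩

theorem ascendingSet_injective (hinf : η.classes.Infinite) :
    Function.Injective (ascendingSet η) := fun m n hmn => by
  refine eq_of_forall_lt_iff fun k => ?_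
  rw [← leastRep_mem_ascendingSet_iff hinf, hmn, leastRep_mem_ascendingSet_iff hinf]

theorem Iio_subset_ascendingSet (hinf : η.classes.Infinite) (n : ℕ) :
    Set.Iio n ⊆ ascendingSet η n := fun x hx => by
  obtain ⟨m, hm, hmx⟩ := exists_rel_leastRep η x
  exact ⟨m, ((leastRep_strictMono hinf).le_apply.trans hmx).trans_lt hx, hm⟩

theorem ascendingSet_zero (η : Setoid ℕ) : ascendingSet η 0 = ∅ := by
  ext
  simp [ascendingSet]

theorem isEtaFinite_ascendingSet (η : Setoid ℕ) (n : ℕ) : IsEtaFinite η (ascendingSet η n) := by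
  have heq : ascendingSet η n = etaSaturation η (leastRep η '' Set.Iio n) := by
    ext x
    simp [ascendingSet, etaSaturation, and_comm]
  rw [heq]
  exact isEtaFinite_etaSaturation η ((Set.finite_Iio n).image _)

theorem lt_length_of_forall_le_leastRep (hinf : η.classes.Infinite) {m : ℕ} {l : List ℕ}
    (hl : ∀ z ≤ leastRep η m, z ∈ etaSaturation η {w | w ∈ l}) : m < l.length := by
  classical
  have hcover : ∀ k ∈ Finset.range (m + 1), ∃ w ∈ l.toFinset, η (leastRep η k) w := fun k hk => by
    obtain ⟨w, hkw, hw⟩ := hl (leastRep η k)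
      ((leastRep_strictMono hinf).monotone (Nat.lt_succ_iff.1 (Finset.mem_range.1 hk)))
    exact ⟨w, List.mem_toFinset.2 hw, hkw⟩
  have hcard := Finset.card_le_card_of_forall_subsingleton (fun k w => η (leastRep η k) w) hcover
    fun w _ j hj k hk => eq_of_leastRep_rel hinf (η.trans hj.2 (η.symm hk.2))
  rw [Finset.card_range] at hcard
  exact hcard.trans l.toFinset_card_le

theorem ascendingSet_eq_etaSaturation (hinf : η.classes.Infinite) (n : ℕ) :
    ascendingSet η n = etaSaturation η {y | ∃ l : List ℕ, l.length ≤ n ∧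
      ∀ z < y + 1, z ∈ etaSaturation η {w | w ∈ l}} := by
  ext x
  constructor
  · rintro ⟨m, hm, hxm⟩
    refine ⟨_, hxm, (List.range n).map (leastRep η), by simp, fun z hz => ?_⟩
    obtain ⟨k, hzk, hk⟩ := exists_rel_leastRep η z
    have hkm : k ≤ m := (leastRep_strictMono hinf).le_iff_le.1 (hk.trans (Nat.lt_succ_iff.1 hz))
    exact ⟨_, hzk, List.mem_map_of_mem (List.mem_range.2 (hkm.trans_lt hm))⟩
  · rintro ⟨y, hxy, l, hln, hl⟩
    obtain ⟨m, hym, hm⟩ := exists_rel_leastRep η y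
    have hml : m < l.length := lt_length_of_forall_le_leastRep hinf fun z hz =>
      hl z (Nat.lt_succ_iff.2 (hz.trans hm))
    exact ⟨m, hml.trans_le hln, η.trans hxy hym⟩

theorem isREFamily_ascendingSet (hη : IsPositive η) (hinf : η.classes.Infinite) :
    IsREFamily (ascendingSet η) := by
  have hcover : REPred fun w : (ℕ × ℕ) × List ℕ => w.2.length ≤ w.1.1 ∧
      ∀ z < w.1.2 + 1, z ∈ etaSaturation η {x | x ∈ w.2} :=
    rePred_and (Primrec.nat_le.comp (Primrec.list_length.comp Primrec.snd)
      (Primrec.fst.comp Primrec.fst)).computablePred.to_re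
      (rePred_comp (rePred_forall_lt (isREFamily_etaSaturation_list hη))
        (Computable.snd.pair (Computable.succ.comp (Computable.snd.comp Computable.fst))))
  have hfew : IsREFamily fun n => {y | ∃ l : List ℕ, l.length ≤ n ∧
      ∀ z < y + 1, z ∈ etaSaturation η {w | w ∈ l}} := rePred_exists hcover
  rw [funext (ascendingSet_eq_etaSaturation hinf)]
  exact hfew.etaSaturation hη

end Ascending

section EtaFamilies

variable {η : Setoid ℕ}

theorem isEtaFamily_of_ascendingFamily_subset (hη : IsPositive η) (hinf : η.classes.Infinite)
    {C : Set (Set ℕ)} (hC : UniformlyRE C) (hsub : ascendingFamily η ⊆ C)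
    (hclosed : ∀ X ∈ C, IsEtaClosed η X) : IsEtaFamily η C := by
  have hempty : ∅ ∈ C := hsub ⟨0, ascendingSet_zero η⟩
  obtain ⟨L, hL, rfl⟩ := hC.exists_range_eq hempty
  exact ⟨(Set.infinite_range_of_injective (ascendingSet_injective hinf)).mono hsub,
    oneOneRE_range_of_range_subset hL (isREFamily_ascendingSet hη hinf)
      (ascendingSet_injective hinf) (Iio_subset_ascendingSet hinf) hsub, hclosed⟩

theorem uniformlyRE_setOf_isEtaFinite (hη : IsPositive η) :
    UniformlyRE {X | IsEtaFinite η X} := by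
  have hrange : Set.range (fun l : List ℕ => etaSaturation η {x | x ∈ l}) =
      {X | IsEtaFinite η X} := by
    refine Set.Subset.antisymm ?_ fun X hX => IsEtaFinite.exists_list hX
    rintro _ ⟨l, rfl⟩
    exact isEtaFinite_etaSaturation η l.finite_toSet
  exact hrange ▸ (isREFamily_etaSaturation_list hη).uniformlyRE_range

theorem uniformlyRE_setOf_isEtaClosed (hη : IsPositive η) :
    UniformlyRE {X | IsEtaClosed η X ∧ REPred (· ∈ X)} := by
  have hfamily : IsREFamily fun e => etaSaturation η (W e) := isREFamily_W.etaSaturation hη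
  have hrange : Set.range (fun e => etaSaturation η (W e)) =
      {X | IsEtaClosed η X ∧ REPred (· ∈ X)} := by
    refine Set.Subset.antisymm ?_ ?_
    · rintro _ ⟨e, rfl⟩
      exact ⟨isEtaClosed_etaSaturation η _,
        hfamily.rePred_mem (Computable.const e) Computable.id⟩
    · rintro X ⟨hX, hre⟩
      obtain ⟨e, rfl⟩ := exists_W_eq hre
      exact ⟨e, hX.etaSaturation_eq⟩
  exact hrange ▸ hfamily.uniformlyRE_range

end EtaFamilies

theorem proposition4p3 (η : Setoid ℕ) (hη : IsPositive η) (hinf : η.classes.Infinite) :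
    (∀ C : Set (Set ℕ), UniformlyRE C → ascendingFamily η ⊆ C →
        (∀ L ∈ C, IsEtaClosed η L) → IsEtaFamily η C) ∧
      IsEtaFamily η {L | IsEtaFinite η L} ∧
      IsEtaFamily η {L | IsEtaClosed η L ∧ REPred (fun x => x ∈ L)} := by
  have hmain := fun C => isEtaFamily_of_ascendingFamily_subset hη hinf (C := C)
  have hre : ∀ n, REPred (· ∈ ascendingSet η n) := fun n =>
    (isREFamily_ascendingSet hη hinf).rePred_mem (Computable.const n) Computable.id
  refine ⟨hmain, hmain _ (uniformlyRE_setOf_isEtaFinite hη) ?_ fun X hX => Or.inl hX,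
    hmain _ (uniformlyRE_setOf_isEtaClosed hη) ?_ fun X hX => hX.1⟩
  · rintro _ ⟨n, rfl⟩
    exact isEtaFinite_ascendingSet η n
  · rintro _ ⟨n, rfl⟩
    exact ⟨Or.inl (isEtaFinite_ascendingSet η n), hre n⟩
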